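/- Let $n\in\mathbb N$, let $H_S\in\mathbb C^{n\times n}$ be Hermitian and let $T\in(0,\infty]$, with the convention $1/\infty=0$ (so $e^{-H/\infty}=\mathbb 1$). For $m\ge 1$, a Hermitian $H_B\in\mathbb C^{m\times m}$ and a unitary $U\in\mathbb C^{n\times n}\otimes\mathbb C^{m\times m}$ let $$\Phi_{T,m}(H_B,U)(X):=\operatorname{tr}_B\Big(U\Big(X\otimes\frac{e^{-H_B/T}}{\operatorname{tr}(e^{-H_B/T})}\Big)U^*\Big),\qquad X\in\mathbb C^{n\times n},$$ where $\operatorname{tr}_B$ is the partial trace over the second tensor factor. The set of thermal operations is $$\mathsf{TO}(H_S,T):=\bigcup_{m\ge 1}\big\{\Phi_{T,m}(H_B,U): H_B^*=H_B,\ U\text{ unitary},\ U(H_S\otimes\mathbb 1+\mathbb 1\otimes H_B)U^*=H_S\otimes\mathbb 1+\mathbb 1\otimes H_B\big\}.$$ A Hermitian $H_B\in\mathbb C^{m\times m}$ is said to have resonant spectrum with respect to $H_S$ if the following undirected graph is connected: its vertices are the eigenvalues of $H_B$, and two distinct eigenvalues are joined by an edge if their difference lies in the spectrum of $\operatorname{ad}_{H_S}=[H_S,\,\cdot\,]$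 on $\mathbb C^{n\times n}$. Closures are taken in the finite-dimensional space of linear maps on $\mathbb C^{n\times n}$; semigroups are with respect to composition. Then: (i) $\mathsf{TO}(H_S,T)$ is a bounded, path-connected semigroup containing the identity map. (ii) $\overline{\mathsf{TO}(H_S,T)}$ is a convex, compact semigroup containing the identity map. (iii) Every element of $\overline{\mathsf{TO}(H_S,T)}$ is completely positive, trace preserving, and has $e^{-H_S/T}$ as a fixed point. (iv) $\overline{\mathsf{TO}(H_S,T)}$ equals the closure of the set of all maps $\Phi_{T,m}(H_B,e^{iH_{\mathrm{tot}}})$ where $m\ge1$, $H_B=\operatorname{diag}(E_1,\dots,E_m)$ with real $E_1\le\dots\le E_m$ has resonant spectrum with respect to $H_S$, and $H_{\mathrm{tot}}\in\mathbb C^{n\times n}\otimes\mathbb C^{m\times m}$ is Hermitian and commutes with $H_S\otimes\mathbb 1+\mathbb 1\otimes H_B$. -/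

import Mathlib

open scoped ENNReal Kronecker ComplexOrder

noncomputable section

namespace ThermalOperations

/-- Linear maps on the complex `n × n` matrices. They are bundled as continuous linear maps, which
in finite dimension is no restriction, so that the space of such maps carries its canonical
(operator norm) topology; `1` is the identity and `*` is composition. -/
abbrev SuperOp (n : ℕ) : Type :=
  Matrix (Fin n) (Fin n) ℂ →L[ℂ] Matrix (Fin n) (Fin n) ℂ

/-- The Boltzmann operator `e^{-H/T}` for `T ∈ (0, ∞]`. For `T = ∞` we have `1 / T = 0`, and it is
the identity matrix. -/
def boltzmann {m : ℕ} (T : ℝ≥0∞) (H : Matrix (Fin m) (Fin m) ℂ) : Matrix (Fin m) (Fin m) ℂ :=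
  NormedSpace.exp (-((T⁻¹.toReal : ℂ) • H))

/-- The Gibbs state `e^{-H/T} / tr(e^{-H/T})`. For `T = ∞` it is the maximally mixed state. -/
def gibbs {m : ℕ} (T : ℝ≥0∞) (H : Matrix (Fin m) (Fin m) ℂ) : Matrix (Fin m) (Fin m) ℂ :=
  (boltzmann T H).trace⁻¹ • boltzmann T H

/-- The partial trace over the second tensor factor. -/
def partialTrace {n m : ℕ} (A : Matrix (Fin n × Fin m) (Fin n × Fin m) ℂ) :
    Matrix (Fin n) (Fin n) ℂ :=
  Matrix.of fun i j => ∑ k, A (i, k) (j, k)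

/-- The map `X ↦ tr_B (U (X ⊗ e^{-H_B/T} / tr(e^{-H_B/T})) U*)`. -/
def thermalMap {n m : ℕ} (T : ℝ≥0∞) (HB : Matrix (Fin m) (Fin m) ℂ)
    (U : Matrix (Fin n × Fin m) (Fin n × Fin m) ℂ) : SuperOp n :=
  LinearMap.toContinuousLinearMap
    { toFun := fun X => partialTrace (U * (X ⊗ₖ gibbs T HB) * U.conjTranspose)
      map_add' := fun X Y => by
        ext i j
        simp [partialTrace, Matrix.add_kronecker, mul_add, add_mul, Finset.sum_add_distrib]
      map_smul' := fun c X => by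
        ext i j
        simp [partialTrace, Matrix.smul_kronecker, Finset.mul_sum] }

/-- The total uncoupled Hamiltonian `H_S ⊗ 1 + 1 ⊗ H_B`. -/
def totalHam {n m : ℕ} (HS : Matrix (Fin n) (Fin n) ℂ) (HB : Matrix (Fin m) (Fin m) ℂ) :
    Matrix (Fin n × Fin m) (Fin n × Fin m) ℂ :=
  HS ⊗ₖ (1 : Matrix (Fin m) (Fin m) ℂ) + (1 : Matrix (Fin n) (Fin n) ℂ) ⊗ₖ HB

/-- The set `TO(H_S, T)` of thermal operations. -/
def TO {n : ℕ} (HS : Matrix (Fin n) (Fin n) ℂ) (T : ℝ≥0∞) : Set (SuperOp n) :=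
  {Φ | ∃ m : ℕ, 1 ≤ m ∧ ∃ HB : Matrix (Fin m) (Fin m) ℂ, HB.IsHermitian ∧
    ∃ U ∈ Matrix.unitaryGroup (Fin n × Fin m) ℂ,
      U * totalHam HS HB * U.conjTranspose = totalHam HS HB ∧ Φ = thermalMap T HB U}

/-- `ad_H = [H, ·]`, that is `X ↦ H X - X H`, as a linear map on the `n × n` matrices. -/
def ad {n : ℕ} (H : Matrix (Fin n) (Fin n) ℂ) : Module.End ℂ (Matrix (Fin n) (Fin n) ℂ) :=
  LinearMap.mulLeft ℂ H - LinearMap.mulRight ℂ H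

/-- The graph whose vertices are the eigenvalues of `H_B`, two distinct ones being joined if their
difference is in the spectrum of `ad_{H_S}` (which is symmetric about `0`). -/
def resonanceGraph {n m : ℕ} (HS : Matrix (Fin n) (Fin n) ℂ) (HB : Matrix (Fin m) (Fin m) ℂ) :
    SimpleGraph (spectrum ℂ HB) :=
  SimpleGraph.fromRel fun x y =>
    (x : ℂ) - (y : ℂ) ∈ spectrum ℂ (ad HS)

/-- `H_B` has resonant spectrum with respect to `H_S`. -/
def IsResonant {n m : ℕ} (HS : Matrix (Fin n) (Fin n) ℂ) (HB : Matrix (Fin m) (Fin m) ℂ) : Prop :=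
  (resonanceGraph HS HB).Connected

/-- The thermal operations `Φ_{T,m}(H_B, e^{i H_tot})` where `H_B = diag(E_1, …, E_m)` with
`E_1 ≤ … ≤ E_m` has resonant spectrum with respect to `H_S`, and the Hermitian matrix `H_tot`
commutes with `H_S ⊗ 1 + 1 ⊗ H_B`. -/
def resonantTO {n : ℕ} (HS : Matrix (Fin n) (Fin n) ℂ) (T : ℝ≥0∞) : Set (SuperOp n) :=
  {Φ | ∃ m : ℕ, 1 ≤ m ∧ ∃ E : Fin m → ℝ, Monotone E ∧
    IsResonant HS (Matrix.diagonal fun i => (E i : ℂ)) ∧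
    ∃ Htot : Matrix (Fin n × Fin m) (Fin n × Fin m) ℂ, Htot.IsHermitian ∧
      Commute Htot (totalHam HS (Matrix.diagonal fun i => (E i : ℂ))) ∧
      Φ = thermalMap T (Matrix.diagonal fun i => (E i : ℂ))
        (NormedSpace.exp (Complex.I • Htot))}

/-- `Φ ⊗ id` acting on `M_n(ℂ) ⊗ M_k(ℂ)`: the map `Φ` is applied to every `n × n` block. -/
def ampliation {n : ℕ} (k : ℕ) (Φ : SuperOp n) (X : Matrix (Fin n × Fin k) (Fin n × Fin k) ℂ) :
    Matrix (Fin n × Fin k) (Fin n × Fin k) ℂ :=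
  Matrix.of fun p q => Φ (Matrix.of fun i j => X (i, p.2) (j, q.2)) p.1 q.1

/-- Completely positive: `Φ ⊗ id_k` preserves positive semi-definiteness for every `k`. -/
def IsCompletelyPositive {n : ℕ} (Φ : SuperOp n) : Prop :=
  ∀ (k : ℕ) (X : Matrix (Fin n × Fin k) (Fin n × Fin k) ℂ),
    X.PosSemidef → (ampliation k Φ X).PosSemidef

/-- Completely positive and trace preserving. -/
def IsCPTP {n : ℕ} (Φ : SuperOp n) : Prop :=
  IsCompletelyPositive Φ ∧ ∀ X, (Φ X).trace = X.trace

/-- A set of linear maps which is closed under composition and contains the identity. -/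
def IsSemigroupWithIdentity {n : ℕ} (S : Set (SuperOp n)) : Prop :=
  (1 : SuperOp n) ∈ S ∧ ∀ Φ ∈ S, ∀ Ψ ∈ S, Φ * Ψ ∈ S

end ThermalOperations

end

/-! Diagonalising the bath Hamiltonian turns a thermal operation into `X ↦ ∑ w_c U_bc X U_bc*`, with
`w` the Gibbs weights of the bath energies `E` and `U_bc` the system blocks of the unitary.
Conservation of energy reads `(H + E_b) U_bc = U_bc (H + E_c)`. `IsCoupling` and `bathMap` record
this for an arbitrary finite index type, so that products and subsets of baths are again baths;
relabelling by `Fin m` returns to `TO`.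

Composition is the product of baths: energies add and blocks multiply. A unitary is `e^{iK}` with
`K` a function of it, so `e^{itK}` keeps every commutation relation and gives a path to the
identity. Unitarity bounds the entries of the images of matrix units by 1, whence compactness.
Exponentiating the intertwining relation gives the Gibbs fixed point.

For convexity, a `k`-fold degenerate bath is a uniform classical register. Controlled on it, `l` of
its `k` states run one coupling and the rest run another, which realises every rational mixture.

For resonance, the relation says `[H, U_bc] = (E_c - E_b) U_bc`, so a nonzero block links only
energies that are equal or differ by an element of the spectrum of `ad H`. The unitary therefore
splits along resonance classes, and the channel is a convex combination of channels with connected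
baths. The closure of `connectedTO` is convex, hence contains `TO`; as `connectedTO ⊆ resonantTO ⊆
TO`, all three closures agree. -/

namespace ThermalOperations

/-! ### Matrix exponentials and logarithms of unitaries. -/

section MatrixAnalysis

open scoped Matrix.Norms.L2Operator in
theorem continuous_matrix_exp {ι : Type*} [Fintype ι] [DecidableEq ι] :
    Continuous (NormedSpace.exp : Matrix ι ι ℂ → Matrix ι ι ℂ) := by
  let _ : NormedAlgebra ℚ (Matrix ι ι ℂ) := .restrictScalars ℚ ℂ _
  exact NormedSpace.exp_continuous

open scoped Matrix.Norms.L2Operator in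
theorem commute_matrix_exp {ι : Type*} [Fintype ι] [DecidableEq ι] {K A : Matrix ι ι ℂ}
    (h : Commute K A) : Commute (NormedSpace.exp K) A := by
  let _ : NormedAlgebra ℚ (Matrix ι ι ℂ) := .restrictScalars ℚ ℂ _
  exact h.exp_left

open scoped Matrix.Norms.L2Operator in
theorem semiconjBy_matrix_exp {ι : Type*} [Fintype ι] [DecidableEq ι] {K A B : Matrix ι ι ℂ}
    (h : SemiconjBy K A B) : SemiconjBy K (NormedSpace.exp A) (NormedSpace.exp B) := by
  let _ : NormedAlgebra ℚ (Matrix ι ι ℂ) := .restrictScalars ℚ ℂ _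
  exact h.exp_right

open scoped Matrix.Norms.L2Operator in
theorem exp_smul_I_mem_unitaryGroup {ι : Type*} [Fintype ι] [DecidableEq ι] {K : Matrix ι ι ℂ}
    (hK : K.IsHermitian) (t : ℝ) :
    NormedSpace.exp ((t : ℂ) • (Complex.I • K)) ∈ Matrix.unitaryGroup ι ℂ := by
  let _ : NormedAlgebra ℚ (Matrix ι ι ℂ) := .restrictScalars ℚ ℂ _
  refine NormedSpace.exp_mem_unitary_of_mem_skewAdjoint ?_
  rw [skewAdjoint.mem_iff, Matrix.star_eq_conjTranspose]
  simp [Matrix.conjTranspose_smul, hK.eq]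

open scoped Matrix.Norms.L2Operator in
/-- A unitary matrix is `e^{iK}` for a Hermitian `K` which commutes with everything that commutes
with the unitary. -/
theorem exists_exp_eq_of_mem_unitaryGroup {ι : Type*} [Fintype ι] [DecidableEq ι]
    {U : Matrix ι ι ℂ} (hU : U ∈ Matrix.unitaryGroup ι ℂ) :
    ∃ K : Matrix ι ι ℂ, K.IsHermitian ∧ (∀ A, Commute U A → Commute K A) ∧
      NormedSpace.exp (Complex.I • K) = U := by
  have hnorm : IsStarNormal U := by
    rw [isStarNormal_iff, Commute, SemiconjBy]
    rw [Matrix.mem_unitaryGroup_iff.mp hU, Matrix.mem_unitaryGroup_iff'.mp hU]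
  have hsub : ∀ z ∈ spectrum ℂ U, ‖z‖ = 1 := fun z hz => by
    simpa using Unitary.spectrum_subset_circle (⟨U, hU⟩ : unitary (Matrix ι ι ℂ)) hz
  have hfin : (spectrum ℂ U).Finite := Matrix.finite_spectrum U
  -- The spectrum is finite, so the branch cut of `Complex.arg` does no harm in the functional
  -- calculus.
  have hc : ∀ f : ℂ → ℂ, ContinuousOn f (spectrum ℂ U) := fun f => hfin.continuousOn f
  refine ⟨cfc (fun z => (Complex.arg z : ℂ)) U, ?_, ?_, ?_⟩
  · have : IsSelfAdjoint (cfc (fun z => (Complex.arg z : ℂ)) U) := by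
      rw [IsSelfAdjoint, ← cfc_star]
      congr 1
      ext z
      simp
    exact this
  · intro A hA
    -- The calculus of a normal element also involves its adjoint, which here is the inverse.
    have h2 : Commute (star U) A := by
      have h1 : star U * U = 1 := Matrix.mem_unitaryGroup_iff'.mp hU
      have h3 : U * star U = 1 := Matrix.mem_unitaryGroup_iff.mp hU
      calc star U * A = star U * (A * U) * star U := by rw [mul_assoc, mul_assoc, h3, mul_one]
        _ = star U * (U * A) * star U := by rw [hA.eq]
        _ = A * star U := by rw [← mul_assoc, h1, one_mul]
    exact (hA.cfc h2 _)
  · rw [← cfc_smul Complex.I _ U (hc _), ← CFC.complex_exp_eq_normedSpace_exp,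
      ← cfc_comp' Complex.exp _ U Complex.continuous_exp.continuousOn (hc _)]
    conv_rhs => rw [← cfc_id ℂ U]
    refine cfc_congr fun z hz => ?_
    have := Complex.norm_mul_exp_arg_mul_I z
    rw [hsub z hz, Complex.ofReal_one, one_mul] at this
    simpa [mul_comm] using this

/-- A unitary is connected to the identity by a path of unitaries that commute with everything
that commutes with it. -/
theorem exists_path_of_mem_unitaryGroup {ι : Type*} [Fintype ι] [DecidableEq ι]
    {U : Matrix ι ι ℂ} (hU : U ∈ Matrix.unitaryGroup ι ℂ) :
    ∃ γ : ℝ → Matrix ι ι ℂ, Continuous γ ∧ γ 0 = 1 ∧ γ 1 = U ∧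
      ∀ t, γ t ∈ Matrix.unitaryGroup ι ℂ ∧ ∀ A, Commute U A → Commute (γ t) A := by
  obtain ⟨K, hK, hcomm, hexp⟩ := exists_exp_eq_of_mem_unitaryGroup hU
  refine ⟨fun t => NormedSpace.exp ((t : ℂ) • (Complex.I • K)), ?_, by simp, by simpa using hexp,
    fun t => ⟨?_, fun A hA => ?_⟩⟩
  · exact continuous_matrix_exp.comp (by fun_prop)
  · exact exp_smul_I_mem_unitaryGroup hK t
  · exact commute_matrix_exp (((hcomm A hA).smul_left _).smul_left _)

end MatrixAnalysis

/-! ### Topology and closures in the space of superoperators. -/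

section Topology

variable {n : ℕ}

/-- A linear map on matrices is determined by its values on the matrix units. -/
noncomputable def matrixUnitEquiv (n : ℕ) :
    (Fin n × Fin n → Matrix (Fin n) (Fin n) ℂ) ≃L[ℂ] SuperOp n :=
  (((Matrix.stdBasis ℂ (Fin n) (Fin n)).constr ℂ).trans
    LinearMap.toContinuousLinearMap).toContinuousLinearEquiv

theorem matrixUnitEquiv_symm_apply (Φ : SuperOp n) (p : Fin n × Fin n) :
    (matrixUnitEquiv n).symm Φ p = Φ (Matrix.single p.1 p.2 1) := by
  obtain ⟨f, rfl⟩ := (matrixUnitEquiv n).surjective Φ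
  rw [ContinuousLinearEquiv.symm_apply_apply, ← Matrix.stdBasis_eq_single]
  exact ((Matrix.stdBasis ℂ (Fin n) (Fin n)).constr_basis ℂ f p).symm

theorem continuous_superOp_iff {X : Type*} [TopologicalSpace X] {f : X → SuperOp n} :
    Continuous f ↔ ∀ A, Continuous fun x => f x A := by
  refine ⟨fun h A => (continuous_eval_const A).comp h, fun h => ?_⟩
  rw [← (matrixUnitEquiv n).symm.toHomeomorph.comp_continuous_iff]
  refine continuous_pi fun p => ?_
  exact (h (Matrix.single p.1 p.2 1)).congr fun x => (matrixUnitEquiv_symm_apply _ _).symm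

theorem isCompact_setOf_entries_le_one (n : ℕ) :
    IsCompact {Φ : SuperOp n | ∀ i j k l, ‖Φ (Matrix.single i j 1) k l‖ ≤ 1} := by
  have h : IsCompact (Set.univ.pi fun _ : Fin n × Fin n => Set.univ.pi fun _ : Fin n =>
      Set.univ.pi fun _ : Fin n => Metric.closedBall (0 : ℂ) 1) :=
    isCompact_univ_pi fun _ => isCompact_univ_pi fun _ => isCompact_univ_pi fun _ =>
      isCompact_closedBall 0 1
  have h' := (matrixUnitEquiv n).symm.toHomeomorph.isCompact_preimage.2 h
  convert h' using 1
  ext Φ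
  have hmem : Φ ∈ (matrixUnitEquiv n).symm.toHomeomorph ⁻¹' (Set.univ.pi fun _ : Fin n × Fin n =>
      Set.univ.pi fun _ : Fin n => Set.univ.pi fun _ : Fin n => Metric.closedBall (0 : ℂ) 1) ↔
      ∀ p k l, (matrixUnitEquiv n).symm Φ p k l ∈ Metric.closedBall (0 : ℂ) 1 := by
    constructor
    · exact fun h p k l => h p trivial k trivial l trivial
    · exact fun h p _ k _ l _ => h p k l
  refine Iff.trans ?_ hmem.symm
  simp only [matrixUnitEquiv_symm_apply, mem_closedBall_zero_iff, Prod.forall]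
  rfl

theorem IsSemigroupWithIdentity.closure {S : Set (SuperOp n)} (h : IsSemigroupWithIdentity S) :
    IsSemigroupWithIdentity (closure S) := by
  have hl : ∀ Φ : SuperOp n, Continuous fun Ψ : SuperOp n => Φ * Ψ := fun Φ =>
    (ContinuousLinearMap.postcomp _ Φ).continuous
  have hr : ∀ Ψ : SuperOp n, Continuous fun Φ : SuperOp n => Φ * Ψ := fun Ψ =>
    (ContinuousLinearMap.precomp _ Ψ).continuous
  refine ⟨subset_closure h.1, fun Φ hΦ Ψ hΨ => ?_⟩
  -- Composition is extended to the closure one factor at a time, so separate continuity suffices.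
  have h1 : ∀ Φ ∈ S, Φ * Ψ ∈ _root_.closure S := fun Φ hΦ =>
    map_mem_closure (hl Φ) hΨ fun Ψ hΨ => h.2 Φ hΦ Ψ hΨ
  simpa using map_mem_closure (hr Ψ) hΦ h1

/-- Rational weights `⌊tk⌋ / k` tend to `t`, so mixtures of points of `S` are limits of points of
`S`; continuity then passes to the closure. -/
theorem convex_closure_of_rational {V : Type*} [AddCommGroup V] [Module ℝ V] [TopologicalSpace V]
    [ContinuousAdd V] [ContinuousSMul ℝ V] {S : Set V}
    (h : ∀ x ∈ S, ∀ y ∈ S, ∀ l k : ℕ, l ≤ k → 0 < k →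
      ((l : ℝ) / k) • x + (1 - (l : ℝ) / k) • y ∈ S) : Convex ℝ (closure S) := by
  have key : ∀ x ∈ S, ∀ y ∈ S, ∀ t : ℝ, 0 ≤ t → t ≤ 1 → t • x + (1 - t) • y ∈ closure S := by
    intro x hx y hy t h0 h1
    have hlim : Filter.Tendsto (fun k : ℕ => (⌊t * (k : ℝ)⌋₊ : ℝ) / k) Filter.atTop (nhds t) :=
      (tendsto_nat_floor_mul_div_atTop h0).comp tendsto_natCast_atTop_atTop
    refine mem_closure_of_tendsto ((hlim.smul_const x).add
      ((tendsto_const_nhds.sub hlim).smul_const y)) ?_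
    filter_upwards [Filter.eventually_gt_atTop 0] with k hk
    refine h x hx y hy _ k ?_ hk
    exact Nat.floor_le_of_le (mul_le_of_le_one_left k.cast_nonneg h1)
  intro x hx y hy a b ha hb hab
  obtain rfl : b = 1 - a := by linarith
  have := map_mem_closure₂ (f := fun x y : V => a • x + (1 - a) • y) (by fun_prop) hx hy
    fun x hx y hy => key x hx y hy a ha (by linarith)
  simpa using this

end Topology

/-! ### Channels in block form, and products, averages and splittings of baths. -/

section BathMap

variable {n : ℕ} {ι κ : Type} [Fintype ι] [Fintype κ]

/-- The Gibbs weights of the energies `E` at inverse temperature `β`. -/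
noncomputable def weight (β : ℝ) (E : ι → ℝ) (i : ι) : ℝ :=
  Real.exp (-(β * E i)) / ∑ j, Real.exp (-(β * E j))

theorem weight_nonneg (β : ℝ) (E : ι → ℝ) (i : ι) : 0 ≤ weight β E i := by
  unfold weight
  positivity

theorem partitionFunction_pos [Nonempty ι] (β : ℝ) (E : ι → ℝ) :
    0 < ∑ j, Real.exp (-(β * E j)) :=
  Finset.sum_pos (fun _ _ => Real.exp_pos _) Finset.univ_nonempty

theorem sum_weight [Nonempty ι] (β : ℝ) (E : ι → ℝ) : ∑ i, weight β E i = 1 := by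
  simp only [weight, ← Finset.sum_div]
  exact div_self (partitionFunction_pos β E).ne'

theorem weight_comp_equiv (β : ℝ) (E : κ → ℝ) (e : ι ≃ κ) (i : ι) :
    weight β (fun i => E (e i)) i = weight β E (e i) := by
  simp only [weight]
  rw [e.sum_comp fun j => Real.exp (-(β * E j))]

theorem weight_add (β : ℝ) (E : ι → ℝ) (F : κ → ℝ) (p : ι × κ) :
    weight β (fun p : ι × κ => E p.1 + F p.2) p = weight β E p.1 * weight β F p.2 := by
  simp only [weight, mul_add, neg_add, Real.exp_add, Fintype.sum_prod_type, ← Finset.mul_sum,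
    ← Finset.sum_mul]
  rw [mul_div_mul_comm]

theorem weight_fst (β : ℝ) (E : ι → ℝ) (p : ι × κ) :
    weight β (fun p : ι × κ => E p.1) p = weight β E p.1 * (Fintype.card κ : ℝ)⁻¹ := by
  simpa [weight] using weight_add β E (fun _ : κ => (0 : ℝ)) p

/-- The map `X ↦ K X K*`. -/
noncomputable def conjMap (K : Matrix (Fin n) (Fin n) ℂ) : SuperOp n :=
  LinearMap.toContinuousLinearMap
    (LinearMap.mulLeft ℂ K ∘ₗ LinearMap.mulRight ℂ K.conjTranspose)

theorem conjMap_apply (K X : Matrix (Fin n) (Fin n) ℂ) :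
    conjMap K X = K * X * K.conjTranspose := by
  simp [conjMap, mul_assoc]

/-- The action on the system of a coupling with blocks `U b c`, when the bath starts in the Gibbs
state of `diag(E)`. -/
noncomputable def bathMap (β : ℝ) (E : ι → ℝ) (U : ι → ι → Matrix (Fin n) (Fin n) ℂ) :
    SuperOp n :=
  ∑ b, ∑ c, (weight β E c : ℂ) • conjMap (U b c)

theorem bathMap_apply (β : ℝ) (E : ι → ℝ) (U : ι → ι → Matrix (Fin n) (Fin n) ℂ)
    (X : Matrix (Fin n) (Fin n) ℂ) :
    bathMap β E U X = ∑ b, ∑ c, (weight β E c : ℂ) • (U b c * X * (U b c).conjTranspose) := by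
  simp only [bathMap, sum_apply, smul_apply, conjMap_apply]

open scoped Classical in
/-- The blocks `U b c` form a unitary which commutes with the Hamiltonian `H ⊗ 1 + 1 ⊗ diag(E)`. -/
structure IsCoupling (H : Matrix (Fin n) (Fin n) ℂ) (E : ι → ℝ)
    (U : ι → ι → Matrix (Fin n) (Fin n) ℂ) : Prop where
  mul_star : ∀ b c, ∑ d, U b d * (U c d).conjTranspose = if b = c then 1 else 0
  star_mul : ∀ b c, ∑ d, (U d b).conjTranspose * U d c = if b = c then 1 else 0
  comm : ∀ b c, H * U b c + (E b : ℂ) • U b c = U b c * H + (E c : ℂ) • U b c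

/-- Any two energies are linked by a chain of energies whose successive differences are in the
spectrum of `ad_H`. -/
def EnergyConnected (H : Matrix (Fin n) (Fin n) ℂ) (E : ι → ℝ) : Prop :=
  ∀ i j, Relation.EqvGen
    (fun i j => E i = E j ∨ (E i : ℂ) - (E j : ℂ) ∈ spectrum ℂ (ad H)) i j

variable {H : Matrix (Fin n) (Fin n) ℂ} {E : ι → ℝ} {F : κ → ℝ}
  {U : ι → ι → Matrix (Fin n) (Fin n) ℂ} {V : κ → κ → Matrix (Fin n) (Fin n) ℂ}

theorem bathMap_comp_equiv (β : ℝ) (F : κ → ℝ) (V : κ → κ → Matrix (Fin n) (Fin n) ℂ)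
    (e : ι ≃ κ) :
    bathMap β (fun i => F (e i)) (fun i j => V (e i) (e j)) = bathMap β F V := by
  simp only [bathMap, weight_comp_equiv]
  rw [← e.sum_comp]
  refine Finset.sum_congr rfl fun b _ => ?_
  rw [← e.sum_comp]

theorem IsCoupling.comp_equiv (h : IsCoupling H F V) (e : ι ≃ κ) :
    IsCoupling H (fun i => F (e i)) (fun i j => V (e i) (e j)) where
  mul_star b c := by
    rw [e.sum_comp fun d => V (e b) d * (V (e c) d).conjTranspose, h.mul_star]
    split_ifs <;> simp_all
  star_mul b c := by
    rw [e.sum_comp fun d => (V d (e b)).conjTranspose * V d (e c), h.star_mul]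
    split_ifs <;> simp_all
  comm b c := h.comm _ _

theorem eqvGen_map {α γ : Type*} {r : α → α → Prop} {s : γ → γ → Prop} (f : α → γ)
    (h : ∀ a b, r a b → s (f a) (f b)) {a b : α} (hab : Relation.EqvGen r a b) :
    Relation.EqvGen s (f a) (f b) := by
  induction hab with
  | rel a b hr => exact .rel _ _ (h a b hr)
  | refl a => exact .refl _
  | symm a b _ ih => exact .symm _ _ ih
  | trans a b c _ _ ih₁ ih₂ => exact .trans _ _ _ ih₁ ih₂

omit [Fintype ι] [Fintype κ] in
theorem EnergyConnected.comp_equiv (h : EnergyConnected H F) (e : ι ≃ κ) :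
    EnergyConnected H (fun i => F (e i)) := fun i j => by
  have := eqvGen_map e.symm (s := fun i j => F (e i) = F (e j) ∨
    (F (e i) : ℂ) - (F (e j) : ℂ) ∈ spectrum ℂ (ad H)) (by simp) (h (e i) (e j))
  simpa using this

/-- The second coupling acts on the system first, each with its own bath; the product of Gibbs
states is the Gibbs state of the summed energies. -/
theorem bathMap_mul (β : ℝ) (E : ι → ℝ) (F : κ → ℝ) (U : ι → ι → Matrix (Fin n) (Fin n) ℂ)
    (V : κ → κ → Matrix (Fin n) (Fin n) ℂ) :
    bathMap β E U * bathMap β F V = bathMap β (fun p : ι × κ => E p.1 + F p.2)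
      (fun p q => U p.1 q.1 * V p.2 q.2) := by
  ext1 X
  simp only [mul_apply_eq_comp, bathMap_apply, weight_add, Fintype.sum_prod_type,
    Finset.sum_mul, Finset.mul_sum, smul_mul_assoc, mul_smul_comm, Finset.smul_sum, smul_smul,
    Complex.ofReal_mul, Matrix.conjTranspose_mul, mul_assoc]
  refine Finset.sum_congr rfl fun b _ => ?_
  exact Finset.sum_comm

theorem IsCoupling.mul (hU : IsCoupling H E U) (hV : IsCoupling H F V) :
    IsCoupling H (fun p : ι × κ => E p.1 + F p.2) (fun p q => U p.1 q.1 * V p.2 q.2) where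
  mul_star := by
    rintro ⟨b, b'⟩ ⟨c, c'⟩
    have h : ∀ d : ι × κ, U b d.1 * V b' d.2 * (U c d.1 * V c' d.2).conjTranspose =
        U b d.1 * (V b' d.2 * (V c' d.2).conjTranspose) * (U c d.1).conjTranspose :=
      fun d => by simp only [Matrix.conjTranspose_mul, mul_assoc]
    simp only [h, Fintype.sum_prod_type, ← Finset.sum_mul, ← Finset.mul_sum, hV.mul_star]
    by_cases h2 : b' = c'
    · subst h2
      simp only [if_true, mul_one, hU.mul_star, Prod.mk.injEq, and_true]
      split_ifs <;> simp_all
    · simp [h2]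
  star_mul := by
    rintro ⟨b, b'⟩ ⟨c, c'⟩
    have h : ∀ d : ι × κ, (U d.1 b * V d.2 b').conjTranspose * (U d.1 c * V d.2 c') =
        (V d.2 b').conjTranspose * ((U d.1 b).conjTranspose * U d.1 c) * V d.2 c' :=
      fun d => by simp only [Matrix.conjTranspose_mul, mul_assoc]
    simp only [h, Fintype.sum_prod_type_right, ← Finset.sum_mul, ← Finset.mul_sum, hU.star_mul]
    by_cases h2 : b = c
    · subst h2
      simp only [if_true, mul_one, hV.star_mul, Prod.mk.injEq, true_and]
      split_ifs <;> simp_all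
    · simp [h2]
  comm := by
    rintro ⟨b, b'⟩ ⟨c, c'⟩
    have h1 := congrArg (· * V b' c') (hU.comm b c)
    have h2 := congrArg (U b c * ·) (hV.comm b' c')
    simp only [add_mul, mul_add, smul_mul_assoc, mul_smul_comm] at h1 h2
    simp only [Complex.ofReal_add, add_smul]
    calc _ = H * U b c * V b' c' + (E b : ℂ) • (U b c * V b' c') +
          (F b' : ℂ) • (U b c * V b' c') := by rw [mul_assoc, add_assoc]
      _ = U b c * (H * V b' c') + (F b' : ℂ) • (U b c * V b' c') +
          (E c : ℂ) • (U b c * V b' c') := by rw [h1, mul_assoc]; abel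
      _ = _ := by rw [h2, mul_assoc]; abel

-- Move one coordinate at a time: the other energy cancels in the difference.
omit [Fintype ι] [Fintype κ] in
theorem EnergyConnected.add (hE : EnergyConnected H E) (hF : EnergyConnected H F) :
    EnergyConnected H (fun p : ι × κ => E p.1 + F p.2) := fun p q =>
  .trans _ (q.1, p.2) _
    (eqvGen_map (fun i => (i, p.2)) (fun i j h => by simpa using h) (hE p.1 q.1))
    (eqvGen_map (fun i => (q.1, i)) (fun i j h => by simpa using h) (hF p.2 q.2))

omit [Fintype ι] [Fintype κ] in
theorem EnergyConnected.fst (hE : EnergyConnected H E) :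
    EnergyConnected H (fun p : ι × κ => E p.1) := fun p q =>
  .trans _ (q.1, p.2) _
    (eqvGen_map (fun i => (i, p.2)) (fun i j h => by simpa using h) (hE p.1 q.1))
    (.rel _ _ (Or.inl rfl))

variable [DecidableEq κ]

/-- The factor `κ` carries no energy, so its Gibbs state is uniform; it is a control register
choosing which coupling `W k` acts. -/
theorem bathMap_average (β : ℝ) (E : ι → ℝ) (W : κ → ι → ι → Matrix (Fin n) (Fin n) ℂ) :
    bathMap β (fun p : ι × κ => E p.1) (fun p q => if p.2 = q.2 then W p.2 p.1 q.1 else 0) =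
      ∑ k, (Fintype.card κ : ℝ)⁻¹ • bathMap β E (W k) := by
  ext1 X
  simp only [bathMap_apply, weight_fst, Fintype.sum_prod_type, sum_apply, smul_apply, ite_mul,
    mul_ite, zero_mul, mul_zero, apply_ite Matrix.conjTranspose, Matrix.conjTranspose_zero,
    smul_ite, smul_zero, Finset.sum_ite_eq, Finset.mem_univ, if_true, Finset.smul_sum]
  rw [Finset.sum_comm]
  refine Finset.sum_congr rfl fun b _ => Finset.sum_congr rfl fun c _ =>
    Finset.sum_congr rfl fun d _ => ?_
  rw [← Complex.coe_smul, smul_smul, mul_comm]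
  push_cast
  rfl

theorem IsCoupling.average {W : κ → ι → ι → Matrix (Fin n) (Fin n) ℂ}
    (h : ∀ k, IsCoupling H E (W k)) :
    IsCoupling H (fun p : ι × κ => E p.1)
      (fun p q => if p.2 = q.2 then W p.2 p.1 q.1 else 0) where
  mul_star := by
    rintro ⟨b, b'⟩ ⟨c, c'⟩
    simp only [Fintype.sum_prod_type, apply_ite Matrix.conjTranspose, Matrix.conjTranspose_zero,
      mul_ite, ite_mul, zero_mul, mul_zero, Finset.sum_ite_eq, Finset.mem_univ, if_true]
    by_cases h2 : b' = c'
    · subst h2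
      simp only [if_true, (h _).mul_star, Prod.mk.injEq, and_true]
      split_ifs <;> simp_all
    · simp [h2]
  star_mul := by
    rintro ⟨b, b'⟩ ⟨c, c'⟩
    simp only [Fintype.sum_prod_type, apply_ite Matrix.conjTranspose, Matrix.conjTranspose_zero,
      mul_ite, ite_mul, zero_mul, mul_zero, Finset.sum_ite_eq', Finset.mem_univ, if_true]
    by_cases h2 : b' = c'
    · subst h2
      simp only [if_true, (h _).star_mul, Prod.mk.injEq, and_true]
      split_ifs <;> simp_all
    · simp [h2, Ne.symm h2]
  comm b c := by
    by_cases h2 : b.2 = c.2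
    · simpa [h2] using (h c.2).comm b.1 c.1
    · simp [h2]

-- Gibbs weights conditioned on a fiber are the Gibbs weights of that fiber.
omit [Fintype κ] in
theorem weight_fiber (β : ℝ) (E : ι → ℝ) (f : ι → κ) (k : κ) (i : {i // f i = k}) :
    (∑ j : {j // f j = k}, weight β E j) * weight β (fun j : {j // f j = k} => E j) i =
      weight β E i := by
  have : Nonempty {j // f j = k} := ⟨i⟩
  have h := (partitionFunction_pos β fun j : {j // f j = k} => E j).ne'
  simp only [weight, ← Finset.sum_div] at h ⊢
  field_simp

/-- If the coupling preserves the fibers of `f`, then the bath splits into the fibers. -/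
theorem bathMap_eq_sum_fiber (β : ℝ) (E : ι → ℝ) {U : ι → ι → Matrix (Fin n) (Fin n) ℂ}
    (f : ι → κ) (hU : ∀ b c, f b ≠ f c → U b c = 0) :
    bathMap β E U = ∑ k, (∑ j : {j // f j = k}, weight β E j) •
      bathMap β (fun j : {j // f j = k} => E j) (fun i j => U i j) := by
  ext1 X
  simp only [bathMap_apply, sum_apply, smul_apply, Finset.smul_sum, ← Complex.coe_smul, smul_smul,
    ← Complex.ofReal_mul, weight_fiber]
  rw [← Fintype.sum_fiberwise f]
  refine Finset.sum_congr rfl fun k _ => Finset.sum_congr rfl fun b _ => ?_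
  rw [← Fintype.sum_subtype_add_sum_subtype (fun j => f j = k), add_eq_left]
  refine Finset.sum_eq_zero fun c _ => ?_
  rw [hU b c fun h => c.2 (h.symm.trans b.2)]
  simp

omit [Fintype κ] in
theorem IsCoupling.fiber (h : IsCoupling H E U) (f : ι → κ)
    (hU : ∀ b c, f b ≠ f c → U b c = 0) (k : κ) :
    IsCoupling H (fun j : {j // f j = k} => E j) (fun i j => U i j) where
  mul_star b c := by
    have := h.mul_star b c
    rw [← Fintype.sum_subtype_add_sum_subtype (fun j => f j = k),
      Finset.sum_eq_zero (s := (Finset.univ : Finset {j // ¬ f j = k})), add_zero] at this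
    · rw [this]
      split_ifs <;> simp_all [Subtype.ext_iff]
    · intro d _
      rw [hU b d fun h => d.2 (h.symm.trans b.2), zero_mul]
  star_mul b c := by
    have := h.star_mul b c
    rw [← Fintype.sum_subtype_add_sum_subtype (fun j => f j = k),
      Finset.sum_eq_zero (s := (Finset.univ : Finset {j // ¬ f j = k})), add_zero] at this
    · rw [this]
      split_ifs <;> simp_all [Subtype.ext_iff]
    · intro d _
      rw [hU d c fun h => d.2 (h.trans c.2), mul_zero]
  comm b c := h.comm b c

omit [DecidableEq κ] in
/-- Blocks between energies in different resonance classes vanish. -/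
theorem IsCoupling.eq_zero (h : IsCoupling H E U) {b c : ι}
    (hbc : ¬ (E c = E b ∨ (E c : ℂ) - (E b : ℂ) ∈ spectrum ℂ (ad H))) : U b c = 0 := by
  by_contra h0
  -- The commutation relation makes a nonzero block an eigenvector of `ad H` with eigenvalue `E c -
  -- E b`.
  refine hbc (Or.inr (Module.End.HasEigenvalue.mem_spectrum
    (Module.End.hasEigenvalue_of_hasEigenvector (x := U b c) ⟨?_, h0⟩)))
  rw [Module.End.mem_eigenspace_iff]
  have := h.comm b c
  simp only [ad, LinearMap.sub_apply, LinearMap.mulLeft_apply, LinearMap.mulRight_apply, sub_smul]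
  rw [sub_eq_sub_iff_add_eq_add, this, add_comm]

/-! ### Trace, complete positivity, Gibbs fixed point and entry bounds. -/

section Channel

theorem IsCoupling.trace_bathMap [Nonempty ι] (h : IsCoupling H E U) (β : ℝ)
    (X : Matrix (Fin n) (Fin n) ℂ) : (bathMap β E U X).trace = X.trace := by
  rw [bathMap_apply, Finset.sum_comm]
  have : ∀ c, ∑ b, (U b c * X * (U b c).conjTranspose).trace = X.trace := fun c => by
    simp_rw [Matrix.trace_mul_comm (_ * X), ← mul_assoc]
    rw [← Matrix.trace_sum, ← Finset.sum_mul, h.star_mul, if_pos rfl, one_mul]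
  simp only [Matrix.trace_sum, Matrix.trace_smul, ← Finset.smul_sum, this]
  rw [← Finset.sum_smul, ← Complex.ofReal_sum, sum_weight]
  simp

/-- This Kraus form makes complete positivity visible. -/
theorem ampliation_bathMap (β : ℝ) (E : ι → ℝ) (U : ι → ι → Matrix (Fin n) (Fin n) ℂ) (k : ℕ)
    (X : Matrix (Fin n × Fin k) (Fin n × Fin k) ℂ) :
    ampliation k (bathMap β E U) X = ∑ b, ∑ c, (weight β E c : ℂ) •
      ((U b c ⊗ₖ (1 : Matrix (Fin k) (Fin k) ℂ)) * X *
        (U b c ⊗ₖ (1 : Matrix (Fin k) (Fin k) ℂ)).conjTranspose) := by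
  ext ⟨i, a⟩ ⟨j, a'⟩
  simp only [ampliation, bathMap_apply, Matrix.of_apply, Matrix.sum_apply, Matrix.smul_apply]
  refine Finset.sum_congr rfl fun b _ => Finset.sum_congr rfl fun c _ => ?_
  congr 1
  simp [Matrix.mul_apply, Fintype.sum_prod_type, Matrix.one_apply, Matrix.kroneckerMap_apply,
    apply_ite (starRingEnd ℂ)]

theorem isCompletelyPositive_bathMap (β : ℝ) (E : ι → ℝ)
    (U : ι → ι → Matrix (Fin n) (Fin n) ℂ) : IsCompletelyPositive (bathMap β E U) := by
  intro k X hX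
  rw [ampliation_bathMap]
  refine Matrix.posSemidef_sum _ fun b _ => Matrix.posSemidef_sum _ fun c _ => ?_
  exact (hX.mul_mul_conjTranspose_same _).smul (by exact_mod_cast weight_nonneg β E c)

/-- `U b c` intertwines `H + E c` with `H + E b`, hence also their Boltzmann exponentials; the
scalar shifts become the Gibbs weights. -/
theorem IsCoupling.weight_smul_mul_exp (h : IsCoupling H E U) (β : ℝ) (b c : ι) :
    (weight β E c : ℂ) • (U b c * NormedSpace.exp (-((β : ℂ) • H))) =
      (weight β E b : ℂ) • (NormedSpace.exp (-((β : ℂ) • H)) * U b c) := by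
  have hexp : ∀ x : ℂ, NormedSpace.exp (-((β : ℂ) • H) + x • (1 : Matrix (Fin n) (Fin n) ℂ)) =
      Complex.exp x • NormedSpace.exp (-((β : ℂ) • H)) := fun x => by
    have h1 : x • (1 : Matrix (Fin n) (Fin n) ℂ) = Matrix.diagonal fun _ => x :=
      Matrix.smul_one_eq_diagonal x
    rw [Matrix.exp_add_of_commute _ _ ((Commute.one_right _).smul_right x), h1,
      Matrix.exp_diagonal]
    have h2 : NormedSpace.exp (fun _ : Fin n => x) = fun _ => Complex.exp x := by
      ext i
      rw [Pi.coe_exp, Complex.exp_eq_exp_ℂ]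
    rw [h2, ← Matrix.smul_one_eq_diagonal, mul_smul_comm, mul_one]
  have hsemi : SemiconjBy (U b c)
      (-((β : ℂ) • H) + (-(β * E c) : ℂ) • (1 : Matrix (Fin n) (Fin n) ℂ))
      (-((β : ℂ) • H) + (-(β * E b) : ℂ) • (1 : Matrix (Fin n) (Fin n) ℂ)) := by
    have := congrArg (fun A => -((β : ℂ) • A)) (h.comm b c)
    simp only [smul_add, smul_smul, neg_add] at this
    simp only [SemiconjBy, mul_add, add_mul, mul_neg, neg_mul, mul_smul_comm, smul_mul_assoc,
      mul_one, one_mul, neg_smul]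
    exact this.symm
  have := (semiconjBy_matrix_exp hsemi).eq
  rw [hexp, hexp, mul_smul_comm, smul_mul_assoc] at this
  have hw : ∀ i, (weight β E i : ℂ) =
      ((∑ j, Real.exp (-(β * E j)) : ℝ) : ℂ)⁻¹ * Complex.exp (-(β * E i)) := fun i => by
    rw [weight, div_eq_inv_mul]
    push_cast
    rfl
  rw [hw, hw, mul_smul, mul_smul, this]

theorem IsCoupling.bathMap_exp [Nonempty ι] (h : IsCoupling H E U) (β : ℝ) :
    bathMap β E U (NormedSpace.exp (-((β : ℂ) • H))) = NormedSpace.exp (-((β : ℂ) • H)) := by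
  rw [bathMap_apply]
  simp only [← smul_mul_assoc, h.weight_smul_mul_exp]
  simp only [smul_mul_assoc, mul_assoc, ← Finset.smul_sum, ← Finset.mul_sum, h.mul_star, if_true,
    mul_one]
  rw [← Finset.sum_smul, ← Complex.ofReal_sum, sum_weight]
  simp

/-- Part of a column of a unitary, whose full squared norm is 1. -/
theorem IsCoupling.sum_norm_sq_le (h : IsCoupling H E U) (c : ι) (k i : Fin n) :
    ∑ b, ‖U b c k i‖ ^ 2 ≤ 1 := by
  have h1 := congrFun (congrFun (h.star_mul c c) i) i
  rw [if_pos rfl, Matrix.one_apply_eq, Matrix.sum_apply] at h1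
  have h2 : ∑ b, ∑ k, ‖U b c k i‖ ^ 2 = 1 := by
    rw [← Complex.ofReal_inj, Complex.ofReal_one, ← h1]
    simp only [Matrix.mul_apply, Matrix.conjTranspose_apply, Complex.ofReal_sum]
    refine Finset.sum_congr rfl fun b _ => Finset.sum_congr rfl fun k _ => ?_
    rw [Complex.star_def, Complex.conj_mul', Complex.ofReal_pow]
  rw [← h2]
  exact Finset.sum_le_sum fun b _ =>
    Finset.single_le_sum (f := fun k => ‖U b c k i‖ ^ 2) (fun _ _ => by positivity)
      (Finset.mem_univ k)

theorem IsCoupling.norm_bathMap_single_le [Nonempty ι] (h : IsCoupling H E U) (β : ℝ)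
    (i j k l : Fin n) : ‖bathMap β E U (Matrix.single i j 1) k l‖ ≤ 1 := by
  have hentry : ∀ b c : ι, (U b c * Matrix.single i j (1 : ℂ) * (U b c).conjTranspose) k l =
      U b c k i * star (U b c l j) := fun b c => by
    rw [Matrix.mul_apply, Finset.sum_eq_single j]
    · simp
    · intro x _ hx
      simp [hx]
    · simp
  rw [bathMap_apply, Finset.sum_comm]
  simp only [Matrix.sum_apply, Matrix.smul_apply, hentry, ← Finset.smul_sum]
  have hin : ∀ c, ‖∑ b, U b c k i * star (U b c l j)‖ ≤ 1 := fun c => by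
    calc _ ≤ ∑ b, ‖U b c k i‖ * ‖U b c l j‖ := by
          refine (norm_sum_le _ _).trans (le_of_eq ?_)
          simp
      _ ≤ ∑ b, (‖U b c k i‖ ^ 2 + ‖U b c l j‖ ^ 2) / 2 :=
          Finset.sum_le_sum fun b _ => by nlinarith [sq_nonneg (‖U b c k i‖ - ‖U b c l j‖)]
      _ ≤ 1 := by
          rw [← Finset.sum_div, Finset.sum_add_distrib]
          linarith [h.sum_norm_sq_le c k i, h.sum_norm_sq_le c l j]
  calc _ ≤ ∑ c, weight β E c * 1 := by
        refine (norm_sum_le _ _).trans (Finset.sum_le_sum fun c _ => ?_)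
        rw [norm_smul, Complex.norm_of_nonneg (weight_nonneg β E c)]
        exact mul_le_mul_of_nonneg_left (hin c) (weight_nonneg β E c)
    _ = 1 := by simp [sum_weight]

end Channel

end BathMap
-- From matrices on the tensor product to blocks.
section Blocks

variable {n : ℕ} {ι : Type} [Fintype ι]

/-- The blocks of a matrix on the tensor product of the system and the bath. -/
def blockOf (A : Matrix (Fin n × ι) (Fin n × ι) ℂ) (b c : ι) : Matrix (Fin n) (Fin n) ℂ :=
  Matrix.of fun i j => A (i, b) (j, c)

/-- The matrix with prescribed blocks. -/
def ofBlocks (V : ι → ι → Matrix (Fin n) (Fin n) ℂ) : Matrix (Fin n × ι) (Fin n × ι) ℂ :=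
  Matrix.of fun p q => V p.2 q.2 p.1 q.1

omit [Fintype ι] in
theorem blockOf_ofBlocks (V : ι → ι → Matrix (Fin n) (Fin n) ℂ) : blockOf (ofBlocks V) = V :=
  rfl

omit [Fintype ι] in
theorem blockOf_injective :
    Function.Injective (blockOf : Matrix (Fin n × ι) (Fin n × ι) ℂ → _) := by
  intro A B h
  ext ⟨i, b⟩ ⟨j, c⟩
  exact congrFun (congrFun (congrFun (congrFun h b) c) i) j

theorem blockOf_mul (A B : Matrix (Fin n × ι) (Fin n × ι) ℂ) (b c : ι) :
    blockOf (A * B) b c = ∑ d, blockOf A b d * blockOf B d c := by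
  ext i j
  simp only [blockOf, Matrix.of_apply, Matrix.mul_apply, Fintype.sum_prod_type_right,
    Matrix.sum_apply]

omit [Fintype ι] in
theorem blockOf_conjTranspose (A : Matrix (Fin n × ι) (Fin n × ι) ℂ) (b c : ι) :
    blockOf A.conjTranspose b c = (blockOf A c b).conjTranspose :=
  rfl

omit [Fintype ι] in
theorem blockOf_one [DecidableEq ι] (b c : ι) :
    blockOf (1 : Matrix (Fin n × ι) (Fin n × ι) ℂ) b c = if b = c then 1 else 0 := by
  ext i j
  by_cases h : b = c <;> simp [blockOf, h, Matrix.one_apply]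

omit [Fintype ι] in
theorem blockOf_kronecker_diagonal [DecidableEq ι] (X : Matrix (Fin n) (Fin n) ℂ) (g : ι → ℂ)
    (b c : ι) : blockOf (X ⊗ₖ Matrix.diagonal g) b c = if b = c then g c • X else 0 := by
  ext i j
  by_cases h : b = c <;> simp [blockOf, h, mul_comm]

theorem blockOf_totalHam {m : ℕ} (H : Matrix (Fin n) (Fin n) ℂ) (E : Fin m → ℝ) (b c : Fin m) :
    blockOf (totalHam H (Matrix.diagonal fun i => (E i : ℂ))) b c =
      if b = c then H + (E c : ℂ) • 1 else 0 := by
  have h : blockOf (totalHam H (Matrix.diagonal fun i => (E i : ℂ))) b c =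
      blockOf (H ⊗ₖ (Matrix.diagonal fun _ : Fin m => (1 : ℂ))) b c +
        blockOf ((1 : Matrix (Fin n) (Fin n) ℂ) ⊗ₖ Matrix.diagonal fun i => (E i : ℂ)) b c := by
    rw [Matrix.diagonal_one]
    rfl
  rw [h, blockOf_kronecker_diagonal, blockOf_kronecker_diagonal]
  split_ifs <;> simp

theorem isCoupling_blockOf_iff {m : ℕ} {H : Matrix (Fin n) (Fin n) ℂ} {E : Fin m → ℝ}
    {U : Matrix (Fin n × Fin m) (Fin n × Fin m) ℂ} :
    IsCoupling H E (blockOf U) ↔ U ∈ Matrix.unitaryGroup (Fin n × Fin m) ℂ ∧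
      Commute U (totalHam H (Matrix.diagonal fun i => (E i : ℂ))) := by
  have h1 : U * star U = 1 ↔ ∀ b c, ∑ d, blockOf U b d * (blockOf U c d).conjTranspose =
      if b = c then 1 else 0 := by
    rw [← blockOf_injective.eq_iff]
    simp only [funext_iff (f := blockOf _), funext_iff (f := blockOf _ _), blockOf_mul,
      Matrix.star_eq_conjTranspose, blockOf_conjTranspose, blockOf_one]
  have h2 : star U * U = 1 ↔ ∀ b c, ∑ d, (blockOf U d b).conjTranspose * blockOf U d c =
      if b = c then 1 else 0 := by
    rw [← blockOf_injective.eq_iff]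
    simp only [funext_iff (f := blockOf _), funext_iff (f := blockOf _ _), blockOf_mul,
      Matrix.star_eq_conjTranspose, blockOf_conjTranspose, blockOf_one]
  have h3 : Commute U (totalHam H (Matrix.diagonal fun i => (E i : ℂ))) ↔
      ∀ b c, H * blockOf U b c + (E b : ℂ) • blockOf U b c =
        blockOf U b c * H + (E c : ℂ) • blockOf U b c := by
    rw [Commute, SemiconjBy, eq_comm, ← blockOf_injective.eq_iff]
    simp only [funext_iff (f := blockOf _), funext_iff (f := blockOf _ _), blockOf_mul,
      blockOf_totalHam, ite_mul, mul_ite, zero_mul, mul_zero, Finset.sum_ite_eq,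
      Finset.sum_ite_eq', Finset.mem_univ, if_true, add_mul, mul_add, smul_mul_assoc,
      mul_smul_comm, one_mul, mul_one]
  rw [h3]
  constructor
  · intro h
    refine ⟨Matrix.mem_unitaryGroup_iff.2 (h1.2 fun b c => ?_), h.comm⟩
    rw [h.mul_star]
    split_ifs <;> rfl
  · rintro ⟨hU, hc⟩
    refine ⟨fun b c => ?_, fun b c => ?_, hc⟩
    · rw [h1.1 (Matrix.mem_unitaryGroup_iff.1 hU)]
      split_ifs <;> rfl
    · rw [h2.1 (Matrix.mem_unitaryGroup_iff'.1 hU)]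
      split_ifs <;> rfl

theorem gibbs_diagonal {m : ℕ} (T : ℝ≥0∞) (E : Fin m → ℝ) :
    gibbs T (Matrix.diagonal fun i => (E i : ℂ)) =
      Matrix.diagonal fun i => (weight T⁻¹.toReal E i : ℂ) := by
  have h : boltzmann T (Matrix.diagonal fun i => (E i : ℂ)) =
      Matrix.diagonal fun i => (Real.exp (-(T⁻¹.toReal * E i)) : ℂ) := by
    rw [boltzmann, ← Matrix.diagonal_smul, Matrix.diagonal_neg, Matrix.exp_diagonal]
    congr 1
    ext i
    rw [Pi.coe_exp, ← Complex.exp_eq_exp_ℂ]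
    simp
  rw [gibbs, h, Matrix.trace_diagonal, ← Matrix.diagonal_smul]
  congr 1
  ext i
  simp [weight, div_eq_inv_mul]

theorem partialTrace_eq_sum {m : ℕ} (A : Matrix (Fin n × Fin m) (Fin n × Fin m) ℂ) :
    partialTrace A = ∑ b, blockOf A b b := by
  ext i j
  simp [partialTrace, blockOf, Matrix.sum_apply]

theorem thermalMap_apply {m : ℕ} (T : ℝ≥0∞) (HB : Matrix (Fin m) (Fin m) ℂ)
    (U : Matrix (Fin n × Fin m) (Fin n × Fin m) ℂ) (X : Matrix (Fin n) (Fin n) ℂ) :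
    thermalMap T HB U X = partialTrace (U * (X ⊗ₖ gibbs T HB) * U.conjTranspose) :=
  rfl

theorem thermalMap_diagonal {m : ℕ} (T : ℝ≥0∞) (E : Fin m → ℝ)
    (U : Matrix (Fin n × Fin m) (Fin n × Fin m) ℂ) :
    thermalMap T (Matrix.diagonal fun i => (E i : ℂ)) U =
      bathMap T⁻¹.toReal E (blockOf U) := by
  ext1 X
  rw [thermalMap_apply, gibbs_diagonal, bathMap_apply, partialTrace_eq_sum]
  simp [blockOf_mul, blockOf_kronecker_diagonal, blockOf_conjTranspose]

theorem continuous_thermalMap {m : ℕ} (T : ℝ≥0∞) (HB : Matrix (Fin m) (Fin m) ℂ) :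
    Continuous (thermalMap T HB : Matrix (Fin n × Fin m) (Fin n × Fin m) ℂ → SuperOp n) := by
  rw [continuous_superOp_iff]
  intro X
  refine continuous_matrix fun i j => ?_
  simp only [thermalMap_apply, partialTrace, Matrix.of_apply]
  refine continuous_finsetSum _ fun k _ => ?_
  exact Continuous.matrix_elem (by fun_prop) _ _

/-- Cyclicity of the partial trace for operators acting on the bath alone. -/
theorem partialTrace_one_kronecker_mul {m : ℕ} (B : Matrix (Fin m) (Fin m) ℂ)
    (A : Matrix (Fin n × Fin m) (Fin n × Fin m) ℂ) :
    partialTrace (((1 : Matrix (Fin n) (Fin n) ℂ) ⊗ₖ B) * A) =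
      partialTrace (A * ((1 : Matrix (Fin n) (Fin n) ℂ) ⊗ₖ B)) := by
  ext i j
  simp only [partialTrace, Matrix.of_apply, Matrix.mul_apply, Fintype.sum_prod_type_right,
    Matrix.kroneckerMap_apply, Matrix.one_apply, ite_mul, one_mul, zero_mul, mul_ite, mul_zero,
    Finset.sum_ite_eq, Finset.sum_ite_eq', Finset.mem_univ, if_true]
  rw [Finset.sum_comm]
  simp only [mul_comm]

theorem partialTrace_conj {m : ℕ} {V : Matrix (Fin m) (Fin m) ℂ} (hV : V * star V = 1)
    (A : Matrix (Fin n × Fin m) (Fin n × Fin m) ℂ) :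
    partialTrace (((1 : Matrix (Fin n) (Fin n) ℂ) ⊗ₖ star V) * A *
      ((1 : Matrix (Fin n) (Fin n) ℂ) ⊗ₖ V)) = partialTrace A := by
  rw [mul_assoc, partialTrace_one_kronecker_mul, mul_assoc, ← Matrix.mul_kronecker_mul, hV,
    one_mul, Matrix.one_kronecker_one, mul_one]

/-- A change of basis of the bath can be absorbed into the unitary, since the partial trace does not
see it. -/
theorem thermalMap_conj {m : ℕ} (T : ℝ≥0∞) {V : Matrix (Fin m) (Fin m) ℂ}
    (hV : V ∈ Matrix.unitaryGroup (Fin m) ℂ) (D : Matrix (Fin m) (Fin m) ℂ)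
    (U : Matrix (Fin n × Fin m) (Fin n × Fin m) ℂ) :
    thermalMap T (V * D * star V) U = thermalMap T D
      (((1 : Matrix (Fin n) (Fin n) ℂ) ⊗ₖ star V) * U *
        ((1 : Matrix (Fin n) (Fin n) ℂ) ⊗ₖ V)) := by
  have h1 := Matrix.mem_unitaryGroup_iff.1 hV
  have h2 := Matrix.mem_unitaryGroup_iff'.1 hV
  have hinv : V⁻¹ = star V := Matrix.inv_eq_right_inv h1
  have hb : boltzmann T (V * D * star V) = V * boltzmann T D * star V := by
    rw [boltzmann, boltzmann, ← hinv, ← Matrix.exp_conj _ _ (.of_mul_eq_one _ h1)]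
    simp
  have hg : gibbs T (V * D * star V) = V * gibbs T D * star V := by
    rw [gibbs, gibbs, hb, Matrix.trace_mul_cycle, h2, one_mul]
    simp
  ext1 X
  rw [thermalMap_apply, thermalMap_apply, hg]
  have hX : X ⊗ₖ (V * gibbs T D * star V) = ((1 : Matrix (Fin n) (Fin n) ℂ) ⊗ₖ V) *
      (X ⊗ₖ gibbs T D) * ((1 : Matrix (Fin n) (Fin n) ℂ) ⊗ₖ star V) := by
    simp [← Matrix.mul_kronecker_mul]
  rw [hX, ← partialTrace_conj h1]
  simp only [Matrix.conjTranspose_mul, Matrix.conjTranspose_kronecker, Matrix.conjTranspose_one,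
    Matrix.star_eq_conjTranspose, Matrix.conjTranspose_conjTranspose, mul_assoc]

end Blocks

/-! ### Thermal and resonant operations as channels in block form. -/

section Characterization

variable {n : ℕ} {H : Matrix (Fin n) (Fin n) ℂ}

theorem bathMap_mem_TO {ι : Type} [Fintype ι] [Nonempty ι] {E : ι → ℝ}
    {V : ι → ι → Matrix (Fin n) (Fin n) ℂ} (h : IsCoupling H E V) (T : ℝ≥0∞) :
    bathMap T⁻¹.toReal E V ∈ TO H T := by
  let e := (Fintype.equivFin ι).symm
  have h' := h.comp_equiv e
  rw [← blockOf_ofBlocks (fun i j => V (e i) (e j)), isCoupling_blockOf_iff] at h'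
  refine ⟨Fintype.card ι, Fintype.card_pos, Matrix.diagonal fun i => (E (e i) : ℂ),
    Matrix.isHermitian_diagonal_of_self_adjoint _ ?_,
    _, h'.1, ?_, ?_⟩
  · ext i
    simp
  · rw [h'.2.eq, mul_assoc, ← Matrix.star_eq_conjTranspose, Matrix.mem_unitaryGroup_iff.1 h'.1,
      mul_one]
  · rw [thermalMap_diagonal, blockOf_ofBlocks, bathMap_comp_equiv]

theorem exists_of_mem_TO {T : ℝ≥0∞} {Φ : SuperOp n} (hΦ : Φ ∈ TO H T) :
    ∃ m : ℕ, Nonempty (Fin m) ∧ ∃ (E : Fin m → ℝ) (V : Fin m → Fin m → Matrix (Fin n) (Fin n) ℂ),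
      IsCoupling H E V ∧ Φ = bathMap T⁻¹.toReal E V := by
  obtain ⟨m, hm, HB, hHB, U, hU, hcomm, rfl⟩ := hΦ
  let V : Matrix (Fin m) (Fin m) ℂ := hHB.eigenvectorUnitary
  have hV : V ∈ Matrix.unitaryGroup (Fin m) ℂ := hHB.eigenvectorUnitary.2
  have h1 := Matrix.mem_unitaryGroup_iff.1 hV
  have h2 := Matrix.mem_unitaryGroup_iff'.1 hV
  let D : Matrix (Fin m) (Fin m) ℂ := Matrix.diagonal fun i => (hHB.eigenvalues i : ℂ)
  have hD : HB = V * D * star V := hHB.spectral_theorem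
  let W : Matrix (Fin n × Fin m) (Fin n × Fin m) ℂ := (1 : Matrix (Fin n) (Fin n) ℂ) ⊗ₖ V
  let W' : Matrix (Fin n × Fin m) (Fin n × Fin m) ℂ := (1 : Matrix (Fin n) (Fin n) ℂ) ⊗ₖ star V
  have hW1 : W * W' = 1 := by simp [W, W', ← Matrix.mul_kronecker_mul, h1]
  have hW2 : W' * W = 1 := by simp [W, W', ← Matrix.mul_kronecker_mul, h2]
  have hW' : W' = star W := by
    simp [W, W', Matrix.star_eq_conjTranspose, Matrix.conjTranspose_kronecker]
  have hWU : W ∈ Matrix.unitaryGroup (Fin n × Fin m) ℂ :=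
    Matrix.mem_unitaryGroup_iff.2 (hW' ▸ hW1)
  have hW'U : W' ∈ Matrix.unitaryGroup (Fin n × Fin m) ℂ := hW' ▸ Unitary.star_mem hWU
  have hH : totalHam H HB = W * totalHam H D * W' := by
    simp [totalHam, W, W', mul_add, add_mul, ← Matrix.mul_kronecker_mul, h1, ← hD]
  have hc : Commute U (totalHam H HB) := by
    have := congrArg (· * U) hcomm
    simp only [mul_assoc] at this
    rw [← Matrix.star_eq_conjTranspose, Matrix.mem_unitaryGroup_iff'.1 hU, mul_one] at this
    exact this
  refine ⟨m, ⟨⟨0, hm⟩⟩, hHB.eigenvalues, blockOf (W' * U * W), ?_, ?_⟩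
  · refine isCoupling_blockOf_iff.2 ⟨mul_mem (mul_mem hW'U hU) hWU, ?_⟩
    have hD' : totalHam H D = W' * totalHam H HB * W := by
      rw [hH]
      simp only [mul_assoc, hW2, mul_one]
      rw [← mul_assoc, hW2, one_mul]
    change W' * U * W * totalHam H D = totalHam H D * (W' * U * W)
    have e1 : W' * U * W * (W' * totalHam H HB * W) = W' * (U * totalHam H HB) * W := by
      calc _ = W' * U * (W * W') * totalHam H HB * W := by simp only [mul_assoc]
        _ = _ := by rw [hW1]; simp only [mul_assoc, mul_one]
    have e2 : W' * totalHam H HB * W * (W' * U * W) = W' * (totalHam H HB * U) * W := by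
      calc _ = W' * totalHam H HB * (W * W') * U * W := by simp only [mul_assoc]
        _ = _ := by rw [hW1]; simp only [mul_assoc, mul_one]
    rw [hD', e1, e2, hc.eq]
  · rw [← thermalMap_diagonal]
    exact (congrArg (fun A => thermalMap T A U) hD).trans (thermalMap_conj T hV D U)

theorem EnergyConnected.isResonant {m : ℕ} (hm : 1 ≤ m) {E : Fin m → ℝ}
    (h : EnergyConnected H E) : IsResonant H (Matrix.diagonal fun i => (E i : ℂ)) := by
  have hmem : ∀ i, (E i : ℂ) ∈ spectrum ℂ (Matrix.diagonal fun i => (E i : ℂ)) := fun i => by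
    rw [spectrum_diagonal]
    exact ⟨i, rfl⟩
  have hreach : ∀ i j, (resonanceGraph H (Matrix.diagonal fun i => (E i : ℂ))).Reachable
      ⟨E i, hmem i⟩ ⟨E j, hmem j⟩ := fun i j => by
    induction h i j with
    | rel i j hr =>
      by_cases hij : E i = E j
      · simp only [hij]
        rfl
      · refine SimpleGraph.Adj.reachable ?_
        rw [resonanceGraph, SimpleGraph.fromRel_adj]
        exact ⟨by simpa using hij, Or.inl (hr.resolve_left hij)⟩
    | refl i => rfl
    | symm i j _ ih => exact ih.symm
    | trans i j k _ _ ih₁ ih₂ => exact ih₁.trans ih₂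
  have : Nonempty (spectrum ℂ (Matrix.diagonal fun i => (E i : ℂ))) :=
    ⟨⟨E ⟨0, hm⟩, hmem ⟨0, hm⟩⟩⟩
  refine ⟨?_⟩
  rintro ⟨x, hx⟩ ⟨y, hy⟩
  obtain ⟨i, rfl⟩ : x ∈ Set.range fun i => (E i : ℂ) := by rwa [← spectrum_diagonal]
  obtain ⟨j, rfl⟩ : y ∈ Set.range fun i => (E i : ℂ) := by rwa [← spectrum_diagonal]
  exact hreach i j

theorem bathMap_mem_resonantTO {ι : Type} [Fintype ι] [Nonempty ι] {E : ι → ℝ}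
    {V : ι → ι → Matrix (Fin n) (Fin n) ℂ} (h : IsCoupling H E V) (hE : EnergyConnected H E)
    (T : ℝ≥0∞) : bathMap T⁻¹.toReal E V ∈ resonantTO H T := by
  let e₀ := (Fintype.equivFin ι).symm
  -- The relabelling also sorts the energies, as `resonantTO` demands monotone ones.
  let e := (Tuple.sort fun i => E (e₀ i)).trans e₀
  have h' := h.comp_equiv e
  rw [← blockOf_ofBlocks (fun i j => V (e i) (e j)), isCoupling_blockOf_iff] at h'
  obtain ⟨K, hK, hcomm, hexp⟩ := exists_exp_eq_of_mem_unitaryGroup h'.1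
  refine ⟨Fintype.card ι, Fintype.card_pos, fun i => E (e i), Tuple.monotone_sort fun i => E (e₀ i),
    (hE.comp_equiv e).isResonant Fintype.card_pos, K, hK, hcomm _ h'.2, ?_⟩
  rw [hexp, thermalMap_diagonal, blockOf_ofBlocks, bathMap_comp_equiv]

theorem resonantTO_subset_TO (H : Matrix (Fin n) (Fin n) ℂ) (T : ℝ≥0∞) :
    resonantTO H T ⊆ TO H T := by
  rintro Φ ⟨m, hm, E, -, -, K, hK, hc, rfl⟩
  have : Nonempty (Fin m) := ⟨⟨0, hm⟩⟩
  rw [thermalMap_diagonal]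
  refine bathMap_mem_TO (isCoupling_blockOf_iff.2 ⟨?_, ?_⟩) T
  · simpa using exp_smul_I_mem_unitaryGroup hK 1
  · exact commute_matrix_exp (hc.smul_left _)

end Characterization

/-! ### Semigroup, paths, compactness, convexity and reduction to resonant baths. -/

section Final

variable {n : ℕ} {H : Matrix (Fin n) (Fin n) ℂ}

open scoped Classical in
theorem bathMap_one {ι : Type} [Fintype ι] [Nonempty ι] (β : ℝ) (E : ι → ℝ) :
    bathMap β E (fun b c => if b = c then (1 : Matrix (Fin n) (Fin n) ℂ) else 0) = 1 := by
  ext1 X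
  simp only [bathMap_apply, ite_mul, mul_ite, zero_mul, mul_zero, apply_ite Matrix.conjTranspose,
    Matrix.conjTranspose_zero, Matrix.conjTranspose_one, one_mul, mul_one, smul_ite, smul_zero,
    Finset.sum_ite_eq, Finset.mem_univ, if_true]
  rw [← Finset.sum_smul, ← Complex.ofReal_sum, sum_weight]
  simp

open scoped Classical in
theorem isCoupling_one {ι : Type} [Fintype ι] (H : Matrix (Fin n) (Fin n) ℂ) (E : ι → ℝ) :
    IsCoupling H E (fun b c => if b = c then (1 : Matrix (Fin n) (Fin n) ℂ) else 0) where
  mul_star b c := by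
    simp only [apply_ite Matrix.conjTranspose, Matrix.conjTranspose_one,
      Matrix.conjTranspose_zero, mul_ite, mul_one, mul_zero, Finset.sum_ite_eq, Finset.mem_univ,
      if_true]
  star_mul b c := by
    simp only [apply_ite Matrix.conjTranspose, Matrix.conjTranspose_one,
      Matrix.conjTranspose_zero, ite_mul, one_mul, zero_mul, Finset.sum_ite_eq',
      Finset.mem_univ, if_true]
  comm b c := by
    split_ifs with h <;> simp [h]

theorem isSemigroupWithIdentity_TO (H : Matrix (Fin n) (Fin n) ℂ) (T : ℝ≥0∞) :
    IsSemigroupWithIdentity (TO H T) := by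
  refine ⟨?_, fun Φ hΦ Ψ hΨ => ?_⟩
  · rw [← bathMap_one T⁻¹.toReal fun _ : Unit => 0]
    exact bathMap_mem_TO (isCoupling_one _ _) T
  · obtain ⟨m, _, E, U, hU, rfl⟩ := exists_of_mem_TO hΦ
    obtain ⟨k, _, F, V, hV, rfl⟩ := exists_of_mem_TO hΨ
    rw [bathMap_mul]
    exact bathMap_mem_TO (hU.mul hV) T

theorem isPathConnected_TO (H : Matrix (Fin n) (Fin n) ℂ) (T : ℝ≥0∞) :
    IsPathConnected (TO H T) := by
  refine ⟨1, (isSemigroupWithIdentity_TO H T).1, fun {Φ} hΦ => ?_⟩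
  obtain ⟨m, _, E, V, hV, rfl⟩ := exists_of_mem_TO hΦ
  rw [← blockOf_ofBlocks V, isCoupling_blockOf_iff] at hV
  obtain ⟨γ, hγ, h0, h1, hγU⟩ := exists_path_of_mem_unitaryGroup hV.1
  refine JoinedIn.ofLine
    (f := fun t => thermalMap T (Matrix.diagonal fun i => (E i : ℂ)) (γ t))
    ((continuous_thermalMap T _).comp hγ).continuousOn ?_ ?_ ?_
  · rw [h0, thermalMap_diagonal, ← bathMap_one T⁻¹.toReal E]
    congr 1
    ext1 b
    ext1 c
    rw [blockOf_one]
    split_ifs <;> rfl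
  · rw [h1, thermalMap_diagonal, blockOf_ofBlocks]
  · rintro _ ⟨t, -, rfl⟩
    simp only [thermalMap_diagonal]
    exact bathMap_mem_TO (isCoupling_blockOf_iff.2 ⟨(hγU t).1, (hγU t).2 _ hV.2⟩) T

theorem closure_TO_subset_entries_le_one (H : Matrix (Fin n) (Fin n) ℂ) (T : ℝ≥0∞) :
    closure (TO H T) ⊆ {Φ : SuperOp n | ∀ i j k l, ‖Φ (Matrix.single i j 1) k l‖ ≤ 1} := by
  refine closure_minimal ?_ (isCompact_setOf_entries_le_one n).isClosed
  intro Φ hΦ i j k l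
  obtain ⟨m, _, E, V, hV, rfl⟩ := exists_of_mem_TO hΦ
  exact hV.norm_bathMap_single_le _ i j k l

theorem isCompact_closure_TO (H : Matrix (Fin n) (Fin n) ℂ) (T : ℝ≥0∞) :
    IsCompact (closure (TO H T)) :=
  (isCompact_setOf_entries_le_one n).of_isClosed_subset isClosed_closure
    (closure_TO_subset_entries_le_one H T)

theorem isClosed_setOf_posSemidef {ι : Type*} [Fintype ι] :
    IsClosed {A : Matrix ι ι ℂ | A.PosSemidef} := by
  simp only [Matrix.posSemidef_iff_dotProduct_mulVec, Set.ofPred_and, Set.ofPred_forall]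
  refine IsClosed.inter ?_ (isClosed_iInter fun x => ?_)
  · exact isClosed_eq (by fun_prop) continuous_id
  · exact isClosed_le continuous_const (by fun_prop)

theorem isClosed_setOf_isCPTP_fixing (A : Matrix (Fin n) (Fin n) ℂ) :
    IsClosed {Φ : SuperOp n | IsCPTP Φ ∧ Φ A = A} := by
  have hev : ∀ X, Continuous fun Φ : SuperOp n => Φ X := fun X => continuous_eval_const X
  simp only [IsCPTP, IsCompletelyPositive, Set.ofPred_and, Set.ofPred_forall]
  refine ((isClosed_iInter fun k => isClosed_iInter fun X => isClosed_iInter fun hX => ?_).inter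
    (isClosed_iInter fun X => ?_)).inter (isClosed_eq (hev A) continuous_const)
  · refine isClosed_setOf_posSemidef.preimage (f := fun Φ : SuperOp n => ampliation k Φ X) ?_
    exact continuous_matrix fun p q => (hev _).matrix_elem p.1 q.1
  · exact isClosed_eq (hev X).matrix_trace continuous_const

theorem closure_TO_subset (H : Matrix (Fin n) (Fin n) ℂ) (T : ℝ≥0∞) :
    closure (TO H T) ⊆ {Φ | IsCPTP Φ ∧ Φ (boltzmann T H) = boltzmann T H} := by
  refine closure_minimal ?_ (isClosed_setOf_isCPTP_fixing _)
  intro Φ hΦ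
  obtain ⟨m, _, E, V, hV, rfl⟩ := exists_of_mem_TO hΦ
  exact ⟨⟨isCompletelyPositive_bathMap _ _ _, hV.trace_bathMap _⟩, hV.bathMap_exp _⟩

/-- The thermal operations whose bath, on an arbitrary finite index set, has connected energies. -/
def connectedTO (H : Matrix (Fin n) (Fin n) ℂ) (T : ℝ≥0∞) : Set (SuperOp n) :=
  {Φ | ∃ (ι : Type) (_ : Fintype ι) (_ : Nonempty ι) (E : ι → ℝ)
    (V : ι → ι → Matrix (Fin n) (Fin n) ℂ), IsCoupling H E V ∧ EnergyConnected H E ∧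
      Φ = bathMap T⁻¹.toReal E V}

theorem connectedTO_subset_resonantTO (H : Matrix (Fin n) (Fin n) ℂ) (T : ℝ≥0∞) :
    connectedTO H T ⊆ resonantTO H T := by
  rintro _ ⟨ι, _, _, E, V, hV, hE, rfl⟩
  exact bathMap_mem_resonantTO hV hE T

theorem continuousSMul_real_superOp (n : ℕ) : ContinuousSMul ℝ (SuperOp n) :=
  ⟨(((Complex.continuous_ofReal.comp continuous_fst).smul continuous_snd :
    Continuous fun p : ℝ × SuperOp n => (p.1 : ℂ) • p.2)).congr fun _ => rfl⟩

theorem convex_closure_connectedTO (H : Matrix (Fin n) (Fin n) ℂ) (T : ℝ≥0∞) :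
    Convex ℝ (closure (connectedTO H T)) := by
  classical
  have := continuousSMul_real_superOp n
  refine convex_closure_of_rational ?_
  rintro _ ⟨ι, _, _, E, U, hU, hE, rfl⟩ _ ⟨κ, _, _, F, V, hV, hF, rfl⟩ l k hlk hk
  have : NeZero k := ⟨hk.ne'⟩
  -- Both couplings are padded by the identity to share the bath `ι × κ`; this leaves their channels
  -- unchanged.
  have hU' := hU.mul (isCoupling_one H F)
  have hV' := (isCoupling_one H E).mul hV
  have eU := bathMap_mul T⁻¹.toReal E F U
    (fun b c => if b = c then (1 : Matrix (Fin n) (Fin n) ℂ) else 0)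
  have eV := bathMap_mul T⁻¹.toReal E F
    (fun b c => if b = c then (1 : Matrix (Fin n) (Fin n) ℂ) else 0) V
  rw [bathMap_one, mul_one] at eU
  rw [bathMap_one, one_mul] at eV
  -- The first `l` register states run `U`, the remaining `k - l` run `V`.
  let W : Fin k → ι × κ → ι × κ → Matrix (Fin n) (Fin n) ℂ := fun a =>
    if a.val < l then fun p q => U p.1 q.1 * (if p.2 = q.2 then 1 else 0)
    else fun p q => (if p.1 = q.1 then 1 else 0) * V p.2 q.2
  have hW : ∀ a, IsCoupling H (fun p : ι × κ => E p.1 + F p.2) (W a) := fun a => by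
    by_cases ha : a.val < l
    · simpa only [W, if_pos ha] using hU'
    · simpa only [W, if_neg ha] using hV'
  refine ⟨(ι × κ) × Fin k, inferInstance, inferInstance, _, _, IsCoupling.average hW,
    (hE.add hF).fst, ?_⟩
  have hsum : ∀ a, bathMap T⁻¹.toReal (fun p : ι × κ => E p.1 + F p.2) (W a) =
      if a.val < l then bathMap T⁻¹.toReal E U else bathMap T⁻¹.toReal F V := fun a => by
    by_cases ha : a.val < l
    · simp only [W, if_pos ha, eU]
    · simp only [W, if_neg ha, eV]
  have hcard : (Finset.univ.filter fun a : Fin k => a.val < l).card = l := by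
    rw [Fin.card_filter_val_lt, min_eq_right hlk]
  have hcard' : (Finset.univ.filter fun a : Fin k => ¬ a.val < l).card = k - l := by
    have := Finset.card_filter_add_card_filter_not (s := Finset.univ)
      (fun a : Fin k => a.val < l)
    rw [hcard, Finset.card_univ, Fintype.card_fin] at this
    omega
  refine Eq.trans ?_ (bathMap_average T⁻¹.toReal (fun p : ι × κ => E p.1 + F p.2) W).symm
  have hk' : (k : ℝ) ≠ 0 := by positivity
  simp only [← Finset.smul_sum, hsum, Finset.sum_ite, Finset.sum_const, hcard, hcard',
    Fintype.card_fin, smul_add, ← Nat.cast_smul_eq_nsmul ℝ, smul_smul, Nat.cast_sub hlk]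
  congr 2 <;> field_simp

theorem TO_subset_closure_connectedTO (H : Matrix (Fin n) (Fin n) ℂ) (T : ℝ≥0∞) :
    TO H T ⊆ closure (connectedTO H T) := by
  classical
  intro Φ hΦ
  obtain ⟨m, _, E, V, hV, rfl⟩ := exists_of_mem_TO hΦ
  let r : Fin m → Fin m → Prop := fun i j =>
    E i = E j ∨ (E i : ℂ) - (E j : ℂ) ∈ spectrum ℂ (ad H)
  let f : Fin m → Quotient (Relation.EqvGen.setoid r) := Quotient.mk _
  have hf : ∀ i j, f i = f j ↔ Relation.EqvGen r i j := fun i j => Quotient.eq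
  have hzero : ∀ b c, f b ≠ f c → V b c = 0 := fun b c hbc =>
    hV.eq_zero fun hr => hbc ((hf b c).2 (.symm _ _ (.rel _ _ hr)))
  rw [bathMap_eq_sum_fiber _ E f hzero]
  -- The coefficients are the total Gibbs weights of the resonance classes.
  refine (convex_closure_connectedTO H T).sum_mem
    (fun k _ => Finset.sum_nonneg fun j _ => weight_nonneg _ _ _) ?_ fun k _ => subset_closure ?_
  · rw [← sum_weight T⁻¹.toReal E]
    exact Fintype.sum_fiberwise f _
  · refine ⟨{j // f j = k}, inferInstance, ?_, _, _, hV.fiber f hzero k, ?_, rfl⟩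
    · obtain ⟨j, rfl⟩ := Quotient.exists_rep k
      exact ⟨⟨j, rfl⟩⟩
    · rintro ⟨i, hi⟩ ⟨j, hj⟩
      have hij := (hf i j).1 (hi.trans hj.symm)
      induction hij with
      | rel i j hr => exact .rel _ _ hr
      | refl i => exact .refl _
      | symm i j _ ih => exact .symm _ _ (ih hj hi)
      | trans i j k' h1 _ ih₁ ih₂ =>
        -- The intermediate energy of a chain stays in the class, so the chain lives in the fiber.
        have hk : f j = k := ((hf i j).2 h1).symm.trans hi
        exact .trans _ ⟨j, hk⟩ _ (ih₁ hi hk) (ih₂ hk hj)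

theorem closure_TO_eq_closure_connectedTO (H : Matrix (Fin n) (Fin n) ℂ) (T : ℝ≥0∞) :
    closure (TO H T) = closure (connectedTO H T) :=
  (closure_minimal (TO_subset_closure_connectedTO H T) isClosed_closure).antisymm
    (closure_mono ((connectedTO_subset_resonantTO H T).trans (resonantTO_subset_TO H T)))

end Final

end ThermalOperations

open ThermalOperations in
theorem proposition1 {n : ℕ} (HS : Matrix (Fin n) (Fin n) ℂ) (hHS : HS.IsHermitian)
    (T : ℝ≥0∞) (hT : 0 < T) :
    (Bornology.IsVonNBounded ℂ (TO HS T) ∧ IsPathConnected (TO HS T) ∧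
      IsSemigroupWithIdentity (TO HS T)) ∧
    (Convex ℝ (closure (TO HS T)) ∧ IsCompact (closure (TO HS T)) ∧
      IsSemigroupWithIdentity (closure (TO HS T))) ∧
    (closure (TO HS T) ⊆ {Φ | IsCPTP Φ ∧ Φ (boltzmann T HS) = boltzmann T HS}) ∧
    closure (TO HS T) = closure (resonantTO HS T) := by
  refine ⟨⟨?_, isPathConnected_TO HS T, isSemigroupWithIdentity_TO HS T⟩,
    ⟨?_, isCompact_closure_TO HS T, (isSemigroupWithIdentity_TO HS T).closure⟩,
    closure_TO_subset HS T, ?_⟩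
  · exact (IsCompact.isVonNBounded ℂ (isCompact_closure_TO HS T)).subset subset_closure
  · rw [closure_TO_eq_closure_connectedTO]
    exact convex_closure_connectedTO HS T
  · refine subset_antisymm ?_ (closure_mono (resonantTO_subset_TO HS T))
    rw [closure_TO_eq_closure_connectedTO]
    exact closure_mono (connectedTO_subset_resonantTO HS T)
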